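/- Let $(X,Y)$ be a dual pair of real vector spaces with separating bilinear pairing $\langle\cdot,\cdot\rangle$, where $X$ carries a locally convex topology compatible with the pairing (its continuous linear functionals are exactly the maps $\langle x^*,\cdot\rangle$, $x^*\in Y$). Let $\Phi:X\to\mathbb{R}\cup\{+\infty\}$ be proper, convex and lower semicontinuous, and suppose that $\Phi$ is epi-pointed: its conjugate $\Phi^*(x^*)=\sup_{x\in X}(\langle x^*,x\rangle-\Phi(x))$ is finite and continuous for the Mackey topology $\tau(Y,X)$ at some point of $Y$. For $x\in\operatorname{dom}\Phi=\{\Phi<+\infty\}$ let $\partial\Phi(x)=\{x^*\in Y:\langle x^*,u-x\rangle\le\Phi(u)-\Phi(x)\ \forall u\in X\}$, and let $\partial\Phi(x)=\emptyset$ otherwise. Let $\bar x\in\operatorname{dom}\Phi$, let $[\Phi\le\Phi(\bar x)]=\{x\in X:\Phi(x)\le\Phi(\bar x)\}$, and let $$\mathrm N_{[\Phi\le\Phi(\bar x)]}(\bar x)=\{x^*\in Y:\langle x^*,x-\bar x\rangle\le 0\ \text{ for all } x\in[\Phi\le\Phi(\bar x)]\}$$ be the normal cone. Then, with upper limits taken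 in the weak* topology $\sigma(Y,X)$, $$\mathrm N_{[\Phi\le\Phi(\bar x)]}(\bar x)=\limsup_{\substack{x\to\bar x,\ \mu\ge0\\ \mu(\Phi(x)-\Phi(\bar x))\to0\\ \mu\langle\cdot,x-\bar x\rangle\to0}}\mu\,\partial\Phi(x)=\limsup_{\substack{\mu\ge0,\ \mu(\Phi(x)-\Phi(\bar x))\to0\\ \mu\langle\cdot,x-\bar x\rangle\to0}}\mu\,\partial\Phi(x).$$ Here the first upper limit is the set of all $\xi\in Y$ such that for every weak* neighbourhood $W$ of $\xi$, every neighbourhood $U$ of $\bar x$ and every $\varepsilon>0$ there are $x\in U$, $\mu\ge0$ and $x^*\in\partial\Phi(x)$ with $|\mu(\Phi(x)-\Phi(\bar x))|<\varepsilon$, $|\mu\langle x^*,x-\bar x\rangle|<\varepsilon$ and $\mu x^*\in W$; the second is defined in the same way with the requirement $x\in U$ omitted. In particular, each $\xi\in\mathrm N_{[\Phi\le\Phi(\bar x)]}(\bar x)$ is the weak* limit of a net $(\mu_ix_i^*)$ with $\mu_i\ge0$, $x_i^*\in\partial\Phi(x_i)$, $x_i\to\bar x$, $\mu_i(\Phi(x_i)-\Phi(\bar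 x))\to0$ and $\mu_i\langle x_i^*,x_i-\bar x\rangle\to0$. -/

import Mathlib

open Set Filter Topology

universe u v

noncomputable section

namespace DualPair

section Topologies

variable {X : Type u} {Y : Type v} [AddCommGroup X] [Module ℝ X] [AddCommGroup Y] [Module ℝ Y]

/-- The weak topology `σ(X, Y)` of the pairing `B`: the coarsest topology on `X` making all
`x ↦ B x y` continuous. The weak* topology `σ(Y, X)` on `Y` is `weakTopology B.flip`. -/
abbrev weakTopology (B : X →ₗ[ℝ] Y →ₗ[ℝ] ℝ) : TopologicalSpace X :=
  TopologicalSpace.induced (fun (x : X) (y : Y) => B x y) Pi.topologicalSpace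

/-- The absolutely convex `σ(X, Y)`-compact subsets of `X`. -/
def absConvexWeaklyCompact (B : X →ₗ[ℝ] Y →ₗ[ℝ] ℝ) : Set (Set X) :=
  {K | AbsConvex ℝ K ∧ @IsCompact X (weakTopology B) K}

/-- The Mackey topology `τ(Y, X)` on `Y`: uniform convergence on the absolutely convex
`σ(X, Y)`-compact subsets of `X`. -/
abbrev mackeyTopology (B : X →ₗ[ℝ] Y →ₗ[ℝ] ℝ) : TopologicalSpace Y :=
  TopologicalSpace.induced
    (fun y : Y => UniformOnFun.ofFun (absConvexWeaklyCompact B) (fun x : X => B x y))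
    inferInstance

/-- The topology of `X` is compatible with the pairing `B`: the continuous linear functionals
on `X` are exactly the maps `x ↦ B x y` with `y : Y`. -/
def IsCompatible [TopologicalSpace X] (B : X →ₗ[ℝ] Y →ₗ[ℝ] ℝ) : Prop :=
  ∀ f : X →ₗ[ℝ] ℝ, Continuous f ↔ ∃ y : Y, ∀ x : X, f x = B x y

end Topologies

section Functions

variable {X : Type u} {Y : Type v} [AddCommGroup X] [Module ℝ X] [AddCommGroup Y] [Module ℝ Y]

/-- The effective domain of `Φ`. -/
def dom (Φ : X → EReal) : Set X := {x | Φ x < ⊤}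

/-- The epigraph of `Φ`, a subset of `X × ℝ`. -/
def epi (Φ : X → EReal) : Set (X × ℝ) := {p | Φ p.1 ≤ (p.2 : EReal)}

/-- `Φ ∈ Γ₀(X)`: `Φ` takes values in `ℝ ∪ {+∞}`, is not identically `+∞`, and its epigraph is
convex and closed. -/
structure IsGammaZero [TopologicalSpace X] (Φ : X → EReal) : Prop where
  ne_bot : ∀ x, Φ x ≠ ⊥
  dom_nonempty : (dom Φ).Nonempty
  convex_epi : Convex ℝ (epi Φ)
  isClosed_epi : IsClosed (epi Φ)

/-- The Fenchel conjugate `Φ*(y) = sup_x (⟨y, x⟩ - Φ x)`. -/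
def conj (B : X →ₗ[ℝ] Y →ₗ[ℝ] ℝ) (Φ : X → EReal) (y : Y) : EReal :=
  ⨆ x : X, ((B x y : ℝ) : EReal) - Φ x

/-- `Φ` is epi-pointed: its conjugate is finite and Mackey-continuous at some point. -/
def EpiPointed (B : X →ₗ[ℝ] Y →ₗ[ℝ] ℝ) (Φ : X → EReal) : Prop :=
  ∃ y₀ : Y, conj B Φ y₀ ≠ ⊥ ∧ conj B Φ y₀ ≠ ⊤ ∧
    @ContinuousAt Y EReal (mackeyTopology B) _ (conj B Φ) y₀

/-- The subdifferential `∂Φ(x)`, which is empty when `x` is outside the domain. -/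
def subdiff (B : X →ₗ[ℝ] Y →ₗ[ℝ] ℝ) (Φ : X → EReal) (x : X) : Set Y :=
  {y | x ∈ dom Φ ∧ ∀ u : X, ((B (u - x) y : ℝ) : EReal) ≤ Φ u - Φ x}

/-- The sublevel set `[Φ ≤ c]`. -/
def sublevel (Φ : X → EReal) (c : EReal) : Set X := {x | Φ x ≤ c}

/-- The normal cone to `S` at `x₀`. -/
def normalCone (B : X →ₗ[ℝ] Y →ₗ[ℝ] ℝ) (S : Set X) (x₀ : X) : Set Y :=
  {y | ∀ x ∈ S, B (x - x₀) y ≤ 0}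

/-- The Painlevé–Kuratowski upper limit of a multifunction `M` along a filter `l`, for the
topology `t` on the target. -/
def upperLimit {U : Type*} {V : Type*} (t : TopologicalSpace V) (l : Filter U)
    (M : U → Set V) : Set V :=
  {v | ∀ W ∈ @nhds V t v, ∀ Z ∈ l, ∃ u ∈ Z, (M u ∩ W).Nonempty}

/-- The multifunction of the parameters `(x, μ, x*)` whose value is `{μ x*}` if `x* ∈ ∂Φ(x)`
and is empty otherwise. -/
def scaledSubdiff (B : X →ₗ[ℝ] Y →ₗ[ℝ] ℝ) (Φ : X → EReal) (p : X × ℝ × Y) : Set Y :=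
  {z | p.2.2 ∈ subdiff B Φ p.1 ∧ z = p.2.1 • p.2.2}

/-- The filter of the parameters `(x, μ, x*)` with `x ∈ dom Φ` and `μ ≥ 0` for the convergences
`μ (Φ x - Φ x₀) → 0` and `μ ⟨x*, x - x₀⟩ → 0` (with `x₀ ∈ dom Φ`). -/
def paramFilter (B : X →ₗ[ℝ] Y →ₗ[ℝ] ℝ) (Φ : X → EReal) (x₀ : X) : Filter (X × ℝ × Y) :=
  𝓟 {p | p.1 ∈ dom Φ ∧ 0 ≤ p.2.1} ⊓
    comap (fun p : X × ℝ × Y => p.2.1 * ((Φ p.1).toReal - (Φ x₀).toReal)) (𝓝 0) ⊓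
    comap (fun p : X × ℝ × Y => p.2.1 * B (p.1 - x₀) p.2.2) (𝓝 0)

/-- The same filter with the additional convergence `x → x₀`. -/
def paramFilterAt [TopologicalSpace X] (B : X →ₗ[ℝ] Y →ₗ[ℝ] ℝ) (Φ : X → EReal) (x₀ : X) :
    Filter (X × ℝ × Y) :=
  comap (fun p : X × ℝ × Y => p.1) (𝓝 x₀) ⊓ paramFilter B Φ x₀

end Functions

end DualPair

end

/-!
Let `ξ` be normal to the sublevel set at `x₀`. By Hahn–Banach and the Fenchel–Moreau theorem,
`(ξ, 0)` lies in the weak* closure of the cone of pairs `(η, r)` such that `η` is an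
`r`-subgradient at `x₀` of some multiple `l Φ`, `l ≥ 0`. Epi-pointedness provides a `y₀` for which
`Φ - ⟨·, y₀⟩` has relatively weakly compact sublevel sets (Moreau), so adding a small multiple of
`y₀` to `η` and of `Φ` to `l Φ` makes the multiplier positive and the tilted function coercive. In
the Brøndsted–Rockafellar argument the minimum of a perturbed function is then attained by
compactness, whence an exact subgradient of `μ Φ` near `η`, at a point near `x₀`. For the converse
inclusion one passes to the limit in `μ ⟨x*, u - x⟩ ≤ μ (Φ u - Φ x)`.
-/

namespace DualPair

section WeakTopology

variable {X : Type u} {Y : Type v} [AddCommGroup X] [Module ℝ X] [AddCommGroup Y] [Module ℝ Y]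
  {B : X →ₗ[ℝ] Y →ₗ[ℝ] ℝ}

theorem weakTopology_isTopologicalAddGroup (B : X →ₗ[ℝ] Y →ₗ[ℝ] ℝ) :
    @IsTopologicalAddGroup X (weakTopology B) _ :=
  inferInstanceAs (IsTopologicalAddGroup (WeakBilin B))

theorem weakTopology_continuousSMul (B : X →ₗ[ℝ] Y →ₗ[ℝ] ℝ) :
    @ContinuousSMul ℝ X _ _ (weakTopology B) :=
  inferInstanceAs (ContinuousSMul ℝ (WeakBilin B))

theorem weakTopology_locallyConvexSpace (B : X →ₗ[ℝ] Y →ₗ[ℝ] ℝ) :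
    @LocallyConvexSpace ℝ X _ _ _ _ (weakTopology B) :=
  inferInstanceAs (LocallyConvexSpace ℝ (WeakBilin B))

theorem isCompatible_weakTopology (B : X →ₗ[ℝ] Y →ₗ[ℝ] ℝ) : @IsCompatible X Y _ _ _ _
    (weakTopology B) B := by
  let := weakTopology B
  refine fun f => ⟨fun hf => ?_, fun ⟨y, hy⟩ => ?_⟩
  · obtain ⟨y, hy⟩ := LinearMap.dualEmbedding_surjective B ⟨f, hf⟩
    exact ⟨y, fun x => (DFunLike.congr_fun hy x).symm⟩
  · exact (funext hy : ⇑f = _) ▸ WeakBilin.eval_continuous B y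

theorem exists_finset_of_mem_nhds_weakTopology {x : X} {W : Set X}
    (hW : W ∈ @nhds X (weakTopology B) x) :
    ∃ (s : Finset Y) (δ : ℝ), 0 < δ ∧ ∀ z, (∀ y ∈ s, |B (z - x) y| < δ) → z ∈ W := by
  obtain ⟨s, δ, hδ, hsW⟩ := (B.weakBilin_withSeminorms.mem_nhds_iff x W).1 hW
  exact ⟨s, δ, hδ, fun z hz => hsW (Seminorm.finset_sup_apply_lt hδ hz)⟩

theorem isClosed_weakTopology_of_separated {C : Set X}
    (h : ∀ x ∉ C, ∃ (y : Y) (r : ℝ), B x y < r ∧ ∀ z ∈ C, r ≤ B z y) :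
    IsClosed[weakTopology B] C := by
  let := weakTopology B
  rw [← isOpen_compl_iff, isOpen_iff_forall_mem_open]
  intro x hx
  obtain ⟨y, r, hxr, hCr⟩ := h x hx
  exact ⟨{z | B z y < r}, fun z hz hzC => hz.not_ge (hCr z hzC),
    isOpen_Iio.preimage (WeakBilin.eval_continuous B y), hxr⟩

end WeakTopology

section Compatible

variable {X : Type u} {Y : Type v} [AddCommGroup X] [Module ℝ X] [AddCommGroup Y] [Module ℝ Y]
  [TopologicalSpace X] {B : X →ₗ[ℝ] Y →ₗ[ℝ] ℝ}

theorem IsCompatible.continuous_pairing (hcomp : IsCompatible B) (y : Y) :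
    Continuous fun x => B x y :=
  (hcomp (B.flip y)).2 ⟨y, fun _ => rfl⟩

theorem IsCompatible.exists_prod_eq (hcomp : IsCompatible B) (φ : StrongDual ℝ (X × ℝ)) :
    ∃ (y : Y) (s : ℝ), ∀ x t, φ (x, t) = B x y + t * s := by
  obtain ⟨y, hy⟩ := (hcomp (φ.comp (ContinuousLinearMap.inl ℝ X ℝ)).toLinearMap).1
    (φ.comp (ContinuousLinearMap.inl ℝ X ℝ)).continuous
  refine ⟨y, φ (0, 1), fun x t => ?_⟩
  calc φ (x, t) = φ (x, 0) + φ (t • (0, 1)) := by rw [← map_add]; simp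
    _ = B x y + t * φ (0, 1) := by rw [map_smul, smul_eq_mul, ← hy x]; rfl

theorem IsCompatible.isClosed_weakTopology [IsTopologicalAddGroup X] [ContinuousSMul ℝ X]
    [LocallyConvexSpace ℝ X] (hcomp : IsCompatible B) {C : Set X} (hC : Convex ℝ C)
    (hCc : IsClosed C) : IsClosed[weakTopology B] C := by
  refine isClosed_weakTopology_of_separated fun x hx => ?_
  obtain ⟨φ, r, hφx, hφC⟩ := geometric_hahn_banach_point_closed hC hCc hx
  obtain ⟨y, hy⟩ := (hcomp φ.toLinearMap).1 φ.continuous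
  exact ⟨y, r, (hy x).symm.trans_lt hφx, fun z hz => (hφC z hz).le.trans_eq (hy z)⟩

end Compatible

section ClosedConvex

variable {X : Type u} {Y : Type v} [AddCommGroup X] [Module ℝ X] [AddCommGroup Y] [Module ℝ Y]
  {B : X →ₗ[ℝ] Y →ₗ[ℝ] ℝ} {D : Set X} {f : X → ℝ}

/-- The `ε`-subdifferential at `x₀` of the function equal to `f` on `D` and to `+∞` elsewhere;
for `ε = 0` it is the subdifferential. -/
def approxSubdiff (B : X →ₗ[ℝ] Y →ₗ[ℝ] ℝ) (D : Set X) (f : X → ℝ) (x₀ : X) (ε : ℝ) : Set Y :=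
  {y | ∀ u ∈ D, B (u - x₀) y ≤ f u - f x₀ + ε}

/-- The function equal to `f` on `D` and to `+∞` elsewhere is convex and lower semicontinuous. -/
structure ClosedConvexOn [TopologicalSpace X] (D : Set X) (f : X → ℝ) : Prop where
  convexOn : ConvexOn ℝ D f
  isClosed_epigraph : IsClosed {p : X × ℝ | p.1 ∈ D ∧ f p.1 ≤ p.2}

variable [TopologicalSpace X]

theorem ClosedConvexOn.smul (hf : ClosedConvexOn D f) {c : ℝ} (hc : 0 < c) :
    ClosedConvexOn D (c • f) := by
  refine ⟨hf.convexOn.smul hc.le, ?_⟩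
  convert hf.isClosed_epigraph.preimage
    (continuous_fst.prodMk (continuous_snd.const_mul c⁻¹) :
      Continuous fun p : X × ℝ => (p.1, c⁻¹ * p.2)) using 1
  ext p
  refine and_congr_right fun _ => ?_
  simpa using! (le_inv_mul_iff₀ hc).symm

theorem ClosedConvexOn.isClosed_le (hf : ClosedConvexOn D f) {g : X → ℝ} (hg : Continuous g) :
    IsClosed {x ∈ D | f x ≤ g x} :=
  hf.isClosed_epigraph.preimage (continuous_id.prodMk hg)

variable [IsTopologicalAddGroup X] [ContinuousSMul ℝ X] [LocallyConvexSpace ℝ X]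

theorem ClosedConvexOn.exists_separation (hf : ClosedConvexOn D f) (hcomp : IsCompatible B)
    (hD : D.Nonempty) {x : X} {r : ℝ} (hx : ¬(x ∈ D ∧ f x ≤ r)) :
    ∃ (w : Y) (s α : ℝ), 0 ≤ s ∧ (∀ u ∈ D, B u w + α ≤ s * f u) ∧ s * r < B x w + α := by
  obtain ⟨φ, α, hφx, hφ⟩ := geometric_hahn_banach_point_closed hf.convexOn.convex_epigraph
    hf.isClosed_epigraph (x := (x, r)) hx
  obtain ⟨w, s, hw⟩ := hcomp.exists_prod_eq φ
  have hepi : ∀ u ∈ D, ∀ t, f u ≤ t → α < B u w + t * s := fun u hu t ht =>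
    hw u t ▸ hφ (u, t) ⟨hu, ht⟩
  rw [hw] at hφx
  refine ⟨-w, s, α, ?_, fun u hu => ?_, ?_⟩
  · obtain ⟨u, hu⟩ := hD
    by_contra! hs
    obtain ⟨t, hft, hαt⟩ := ((eventually_ge_atTop (f u)).and
      ((tendsto_id.atTop_mul_const_of_neg hs).eventually_le_atBot (α - B u w))).exists
    have := hepi u hu t hft
    simp only [id] at hαt
    linarith
  · have := hepi u hu (f u) le_rfl
    simp only [map_neg]
    linarith
  · simp only [map_neg]
    linarith

theorem ClosedConvexOn.exists_affine_minorant (hf : ClosedConvexOn D f) (hcomp : IsCompatible B)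
    (hD : D.Nonempty) : ∃ (y : Y) (β : ℝ), ∀ u ∈ D, B u y + β ≤ f u := by
  obtain ⟨x, hx⟩ := hD
  obtain ⟨w, s, α, -, hle, hlt⟩ := hf.exists_separation hcomp ⟨x, hx⟩ (x := x) (r := f x - 1)
    (fun h => by linarith [h.2])
  have hs : 0 < s := by linarith [hle x hx]
  refine ⟨s⁻¹ • w, s⁻¹ * α, fun u hu => ?_⟩
  rw [map_smul, smul_eq_mul, ← mul_add]
  exact (inv_mul_le_iff₀ hs).2 (hle u hu)

-- Adding a large multiple of the separating functional to a fixed minorant covers the vertical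
-- case `s = 0` too.
theorem ClosedConvexOn.exists_affine_minorant_gt (hf : ClosedConvexOn D f)
    (hcomp : IsCompatible B) (hD : D.Nonempty) {x : X} {r : ℝ} (hx : ¬(x ∈ D ∧ f x ≤ r)) :
    ∃ (y : Y) (β : ℝ), (∀ u ∈ D, B u y + β ≤ f u) ∧ r < B x y + β := by
  obtain ⟨y, β, hy⟩ := hf.exists_affine_minorant hcomp hD
  obtain ⟨w, s, α, hs, hle, hlt⟩ := hf.exists_separation hcomp hD hx
  obtain ⟨n, hn⟩ := exists_nat_gt ((r - (B x y + β)) / (B x w + α - s * r))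
  rw [div_lt_iff₀ (sub_pos.2 hlt)] at hn
  have hpos : 0 < 1 + n * s := by positivity
  have hval : ∀ u, B u ((1 + n * s)⁻¹ • (y + (n : ℝ) • w)) + (1 + n * s)⁻¹ * (β + n * α) =
      (1 + n * s)⁻¹ * (B u y + β + n * (B u w + α)) := fun u => by
    simp only [map_smul, map_add, smul_eq_mul]
    ring
  refine ⟨(1 + n * s)⁻¹ • (y + (n : ℝ) • w), (1 + n * s)⁻¹ * (β + n * α), fun u hu => ?_, ?_⟩
  · rw [hval, inv_mul_le_iff₀ hpos]
    have := mul_le_mul_of_nonneg_left (hle u hu) n.cast_nonneg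
    linarith [hy u hu]
  · rw [hval, lt_inv_mul_iff₀ hpos]
    linarith

theorem ClosedConvexOn.le_of_forall_approxSubdiff (hf : ClosedConvexOn D f)
    (hcomp : IsCompatible B) {x₀ x : X} (hx₀ : x₀ ∈ D)
    (hx : ∀ ε, ∀ y ∈ approxSubdiff B D f x₀ ε, B (x - x₀) y ≤ ε) : x ∈ D ∧ f x ≤ f x₀ := by
  by_contra hlt
  obtain ⟨y, β, hle, hlt⟩ := hf.exists_affine_minorant_gt hcomp ⟨x₀, hx₀⟩ hlt
  have hy : y ∈ approxSubdiff B D f x₀ (f x₀ - (B x₀ y + β)) := fun u hu => by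
    rw [map_sub, LinearMap.sub_apply]
    linarith [hle u hu]
  have := hx _ y hy
  rw [map_sub, LinearMap.sub_apply] at this
  linarith

end ClosedConvex

section Coercive

open scoped Pointwise

variable {X : Type u} {Y : Type v} [AddCommGroup X] [Module ℝ X] [AddCommGroup Y] [Module ℝ Y]
  {B : X →ₗ[ℝ] Y →ₗ[ℝ] ℝ}

theorem IsCompatible.exists_polar_separation [TopologicalSpace X] [IsTopologicalAddGroup X]
    [ContinuousSMul ℝ X] [LocallyConvexSpace ℝ X] (hcomp : IsCompatible B) {S : Set X}
    (hS : AbsConvex ℝ S) (hne : S.Nonempty) {x : X} (hx : x ∉ closure S) :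
    ∃ y, (∀ k ∈ S, |B k y| < 1) ∧ 1 < B x y := by
  obtain ⟨φ, α, hφS, hφx⟩ := geometric_hahn_banach_closed_point hS.2.closure isClosed_closure hx
  obtain ⟨w, hw⟩ := (hcomp φ.toLinearMap).1 φ.continuous
  have hwS : ∀ k ∈ S, B k w < α := fun k hk => (hw k).symm.trans_lt (hφS k (subset_closure hk))
  have hα : 0 < α := by simpa using hwS 0 (hS.1.zero_mem hne)
  refine ⟨α⁻¹ • w, fun k hk => ?_, ?_⟩
  · have hneg := hwS (-k) (hS.1.neg_mem_iff.2 hk)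
    rw [map_neg, LinearMap.neg_apply] at hneg
    rw [map_smul, smul_eq_mul, abs_mul, abs_of_pos (inv_pos.2 hα), inv_mul_lt_one₀ hα]
    exact abs_lt.2 ⟨by linarith, hwS k hk⟩
  · rw [map_smul, smul_eq_mul, lt_inv_mul_iff₀ hα, mul_one]
    exact hφx.trans_eq (hw x)

theorem directedOn_absConvexWeaklyCompact (B : X →ₗ[ℝ] Y →ₗ[ℝ] ℝ) :
    DirectedOn (· ⊆ ·) (absConvexWeaklyCompact B) := by
  intro K hK L hL
  rcases K.eq_empty_or_nonempty with rfl | hKne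
  · exact ⟨L, hL, empty_subset _, subset_rfl⟩
  rcases L.eq_empty_or_nonempty with rfl | hLne
  · exact ⟨K, hK, subset_rfl, empty_subset _⟩
  let := weakTopology B
  have := weakTopology_isTopologicalAddGroup B
  exact ⟨K + L, ⟨⟨hK.1.1.add hL.1.1, hK.1.2.add hL.1.2⟩, IsCompact.add hK.2 hL.2⟩,
    subset_add_left K (hL.1.1.zero_mem hLne), subset_add_right L (hK.1.1.zero_mem hKne)⟩

theorem singleton_zero_mem_absConvexWeaklyCompact (B : X →ₗ[ℝ] Y →ₗ[ℝ] ℝ) :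
    {0} ∈ absConvexWeaklyCompact B :=
  ⟨⟨balanced_zero, convex_singleton 0⟩, @isCompact_singleton X (weakTopology B) 0⟩

theorem exists_absConvex_of_mem_nhds_mackeyTopology {y₀ : Y} {V : Set Y}
    (hV : V ∈ @nhds Y (mackeyTopology B) y₀) :
    ∃ K ∈ absConvexWeaklyCompact B, K.Nonempty ∧ ∃ δ > 0,
      ∀ y, (∀ k ∈ K, |B k y| < δ) → y₀ + y ∈ V := by
  rw [nhds_induced, Filter.mem_comap] at hV
  obtain ⟨T, hT, hTV⟩ := hV
  obtain ⟨⟨K, δ⟩, ⟨hK, hδ⟩, hKT⟩ := (UniformOnFun.hasBasis_nhds_of_basis X ℝ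
    (absConvexWeaklyCompact B) _ ⟨_, singleton_zero_mem_absConvexWeaklyCompact B⟩
    (directedOn_absConvexWeaklyCompact B) Metric.uniformity_basis_dist).mem_iff.1 hT
  obtain ⟨L, hL, hKL, h0L⟩ := directedOn_absConvexWeaklyCompact B K hK {0}
    (singleton_zero_mem_absConvexWeaklyCompact B)
  refine ⟨L, hL, ⟨0, h0L rfl⟩, δ, hδ, fun y hy => hTV (hKT fun k hk => ?_)⟩
  simpa [Real.dist_eq] using! hy k (hKL hk)

/-- Coercivity of the function equal to `g` on `D` and to `+∞` elsewhere, for the weak topology: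
its sublevel sets are contained in `σ(X, Y)`-compact sets. -/
def WeaklyCoerciveOn (B : X →ₗ[ℝ] Y →ₗ[ℝ] ℝ) (D : Set X) (g : X → ℝ) : Prop :=
  Tendsto g (@cocompact X (weakTopology B) ⊓ 𝓟 D) atTop

-- Sublevel sets of `g` are polar to a multiple of the polar of `K`, hence lie in multiples of `K`.
theorem weaklyCoerciveOn_of_conj_le {D : Set X} {g : X → ℝ} {K : Set X}
    (hK : K ∈ absConvexWeaklyCompact B) (hne : K.Nonempty) {δ M : ℝ} (hδ : 0 < δ)
    (hg : ∀ y, (∀ k ∈ K, |B k y| < δ) → ∀ u ∈ D, B u y - g u ≤ M) :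
    WeaklyCoerciveOn B D g := by
  let := weakTopology B
  have := weakTopology_isTopologicalAddGroup B
  have := weakTopology_continuousSMul B
  have := weakTopology_locallyConvexSpace B
  refine tendsto_atTop.2 fun c => eventually_inf_principal.2 ?_
  obtain ⟨t, ht, hct⟩ : ∃ t > 0, c + M < δ * t := by
    obtain ⟨t, ht, hct⟩ := ((eventually_gt_atTop 0).and
      (eventually_gt_atTop ((c + M) / δ))).exists
    exact ⟨t, ht, (div_lt_iff₀' hδ).1 hct⟩
  filter_upwards [((show IsCompact K from hK.2).closure.smul t).compl_mem_cocompact] with x hx hxD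
  rw [mem_compl_iff, mem_smul_set_iff_inv_smul_mem₀ ht.ne'] at hx
  obtain ⟨y, hyK, hyx⟩ := (isCompatible_weakTopology B).exists_polar_separation hK.1 hne hx
  have hyδ : ∀ k ∈ K, |B k (δ • y)| < δ := fun k hk => by
    rw [map_smul, smul_eq_mul, abs_mul, abs_of_pos hδ]
    exact mul_lt_of_lt_one_right hδ (hyK k hk)
  rw [map_smul, LinearMap.smul_apply, smul_eq_mul, lt_inv_mul_iff₀ ht, mul_one] at hyx
  have hgx := hg _ hyδ x hxD
  rw [map_smul, smul_eq_mul] at hgx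
  linarith [mul_lt_mul_of_pos_left hyx hδ]

end Coercive

section Minimization

theorem exists_isMinOn_of_tendsto_cocompact {E : Type*} [TopologicalSpace E] {D : Set E}
    {g : E → ℝ} (hD : D.Nonempty) (hcl : ∀ c, IsClosed {x ∈ D | g x ≤ c})
    (hg : Tendsto g (cocompact E ⊓ 𝓟 D) atTop) : ∃ x ∈ D, IsMinOn g D x := by
  obtain ⟨x₁, hx₁⟩ := hD
  set S := {x ∈ D | g x ≤ g x₁}
  have hScomp : IsCompact S := by
    obtain ⟨K, hK, hKS⟩ := mem_cocompact.1
      (eventually_inf_principal.1 (hg.eventually_gt_atTop (g x₁)))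
    exact hK.of_isClosed_subset (hcl _) fun x hx => by_contra fun hxK =>
      hx.2.not_gt (hKS hxK hx.1)
  have hlsc : LowerSemicontinuousOn g S :=
    lowerSemicontinuousOn_iff_preimage_Iic.2 fun c => ⟨{x ∈ D | g x ≤ c}, hcl c,
      Set.ext fun _ => ⟨fun h => ⟨h.1, h.1.1, h.2⟩, fun h => ⟨h.1, h.2.2⟩⟩⟩
  obtain ⟨x, hxS, hx⟩ := hlsc.exists_isMinOn ⟨x₁, show x₁ ∈ S from ⟨hx₁, le_rfl⟩⟩ hScomp
  refine ⟨x, hxS.1, fun u hu => ?_⟩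
  rcases le_total (g u) (g x₁) with h | h
  · exact hx (show u ∈ S from ⟨hu, h⟩)
  · exact hxS.2.trans h

variable {X : Type u} {Y : Type v} [AddCommGroup X] [Module ℝ X] [AddCommGroup Y] [Module ℝ Y]
  {B : X →ₗ[ℝ] Y →ₗ[ℝ] ℝ} {D : Set X} {f : X → ℝ} [TopologicalSpace X]

theorem ClosedConvexOn.exists_isMinOn_add [IsTopologicalAddGroup X] [ContinuousSMul ℝ X]
    [LocallyConvexSpace ℝ X] (hf : ClosedConvexOn D f) (hcomp : IsCompatible B)
    (hD : D.Nonempty) {g : X → ℝ} (hgc : Continuous g) (hg : ConvexOn ℝ univ g)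
    (hcoe : WeaklyCoerciveOn B D (f + g)) : ∃ x ∈ D, IsMinOn (f + g) D x := by
  refine @exists_isMinOn_of_tendsto_cocompact X (weakTopology B) D _ hD (fun c => ?_) hcoe
  have hconv : ConvexOn ℝ D (f + g) :=
    hf.convexOn.add (hg.subset (subset_univ D) hf.convexOn.1)
  refine hcomp.isClosed_weakTopology (hconv.convex_le c) ?_
  simpa only [Pi.add_apply, ← le_sub_iff_add_le] using
    hf.isClosed_le (show Continuous fun x => c - g x by fun_prop)

end Minimization

section BrondstedRockafellar

variable {X : Type u} {Y : Type v} [AddCommGroup X] [Module ℝ X] [AddCommGroup Y] [Module ℝ Y]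
  {B : X →ₗ[ℝ] Y →ₗ[ℝ] ℝ} {D : Set X} {f g : X → ℝ}

theorem abs_pairing_sub_le_of_neg_mem_approxSubdiff {q : Seminorm ℝ X} {x₀ x : X} {y z : Y}
    (hz : -z ∈ approxSubdiff B univ (fun a => q (a - x₀) - B a y) x 0) (a : X) :
    |B a (z - y)| ≤ q a := by
  have hle : ∀ a, B a (y - z) ≤ q a := fun a => by
    have hza := hz (a + x) (mem_univ _)
    simp only [add_sub_cancel_right, add_sub_assoc, map_add, map_neg, LinearMap.add_apply] at hza
    rw [map_sub]
    linarith [map_add_le_add q a (x - x₀)]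
  have hneg := hle (-a)
  rw [map_neg, LinearMap.neg_apply, map_neg_eq_map] at hneg
  rw [← neg_sub y z, map_neg, abs_neg]
  exact abs_le.2 ⟨by linarith, hle a⟩

variable [TopologicalSpace X] [IsTopologicalAddGroup X] [ContinuousSMul ℝ X]

theorem IsCompatible.exists_affine_between (hcomp : IsCompatible B) (hD : D.Nonempty)
    (hf : ConvexOn ℝ D f) (hg : ConcaveOn ℝ univ g) (hgc : Continuous g)
    (hgf : ∀ u ∈ D, g u ≤ f u) :
    ∃ (y : Y) (β : ℝ), (∀ a, g a ≤ B a y + β) ∧ ∀ u ∈ D, B u y + β ≤ f u := by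
  have hopen : IsOpen {p : X × ℝ | p.1 ∈ univ ∧ p.2 < g p.1} := by
    simpa using isOpen_lt continuous_snd (hgc.comp continuous_fst)
  have hdisj : Disjoint {p : X × ℝ | p.1 ∈ univ ∧ p.2 < g p.1} {p | p.1 ∈ D ∧ f p.1 ≤ p.2} :=
    disjoint_left.2 fun p hp hp' => (hp.2.trans_le (hgf _ hp'.1)).not_ge hp'.2
  obtain ⟨φ, α, hφg, hφf⟩ := geometric_hahn_banach_open hg.convex_strict_hypograph hopen
    hf.convex_epigraph hdisj
  obtain ⟨w, s, hw⟩ := hcomp.exists_prod_eq φ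
  have hlt : ∀ a t, t < g a → B a w + t * s < α := fun a t ht =>
    hw a t ▸ hφg (a, t) ⟨mem_univ a, ht⟩
  have hle : ∀ u ∈ D, α ≤ B u w + f u * s := fun u hu => hw u (f u) ▸ hφf (u, f u) ⟨hu, le_rfl⟩
  have hs : 0 < s := by
    obtain ⟨u, hu⟩ := hD
    have hsep := (hlt u (g u - 1) (sub_one_lt _)).trans_le (hle u hu)
    exact pos_of_mul_pos_right (a := f u - (g u - 1)) (by linarith) (by linarith [hgf u hu])
  have hval : ∀ a, B a (-s⁻¹ • w) + s⁻¹ * α = s⁻¹ * (α - B a w) := fun a => by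
    simp only [map_smul, smul_eq_mul]
    ring
  refine ⟨-s⁻¹ • w, s⁻¹ * α, fun a => ?_, fun u hu => ?_⟩
  · refine le_of_forall_lt fun t ht => ?_
    rw [hval, lt_inv_mul_iff₀ hs]
    linarith [hlt a t ht]
  · rw [hval, inv_mul_le_iff₀ hs]
    linarith [hle u hu]

theorem IsCompatible.exists_mem_approxSubdiff_of_isMinOn_add (hcomp : IsCompatible B)
    (hf : ConvexOn ℝ D f) (hg : ConvexOn ℝ univ g) (hgc : Continuous g) {x : X} (hx : x ∈ D)
    (hmin : IsMinOn (f + g) D x) :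
    ∃ z ∈ approxSubdiff B D f x 0, -z ∈ approxSubdiff B univ g x 0 := by
  obtain ⟨z, β, hgz, hzf⟩ := hcomp.exists_affine_between ⟨x, hx⟩ hf
    (hg.neg.add_const (f x + g x)) (hgc.neg.add continuous_const)
    fun u hu => by
      have : f x + g x ≤ f u + g u := hmin hu
      simp only [Pi.add_apply, Pi.neg_apply]
      linarith
  simp only [Pi.add_apply, Pi.neg_apply] at hgz
  have hzx : B x z + β = f x := le_antisymm (hzf x hx) (by linarith [hgz x])
  refine ⟨z, fun u hu => ?_, fun a _ => ?_⟩
  · rw [map_sub, LinearMap.sub_apply]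
    linarith [hzf u hu]
  · rw [map_neg, map_sub, LinearMap.sub_apply]
    linarith [hgz a]

-- Weak coercivity replaces Ekeland's principle: `f - ⟨·, y⟩ + q (· - x₀)` attains its minimum.
theorem ClosedConvexOn.exists_approxSubdiff_near [LocallyConvexSpace ℝ X]
    (hf : ClosedConvexOn D f) (hcomp : IsCompatible B) {x₀ : X} (hx₀ : x₀ ∈ D) {ε : ℝ} {y : Y}
    (hy : y ∈ approxSubdiff B D f x₀ ε) (hcoe : WeaklyCoerciveOn B D fun u => f u - B u y)
    {q : Seminorm ℝ X} (hq : Continuous q) :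
    ∃ x ∈ D, ∃ z ∈ approxSubdiff B D f x 0, q (x - x₀) ≤ ε ∧
      |f x - f x₀ - B (x - x₀) y| ≤ ε ∧ ∀ a, |B a (z - y)| ≤ q a := by
  set g : X → ℝ := fun a => q (a - x₀) - B a y
  have hgconv : ConvexOn ℝ univ g := by
    have hqx₀ : ConvexOn ℝ univ fun a => q (a - x₀) := by
      simpa only [sub_eq_add_neg] using! q.convexOn.translate_left (-x₀)
    exact hqx₀.sub ((B.flip y).concaveOn convex_univ)
  have hgcont : Continuous g :=
    (hq.comp (continuous_sub_right x₀)).sub (hcomp.continuous_pairing y)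
  have hgcoe : WeaklyCoerciveOn B D (f + g) := tendsto_atTop_mono
    (fun u => show f u - B u y ≤ f u + (q (u - x₀) - B u y) by
      linarith [apply_nonneg q (u - x₀)]) hcoe
  obtain ⟨x, hx, hmin⟩ := hf.exists_isMinOn_add hcomp ⟨x₀, hx₀⟩ hgcont hgconv hgcoe
  obtain ⟨z, hz, hzg⟩ :=
    hcomp.exists_mem_approxSubdiff_of_isMinOn_add hf.convexOn hgconv hgcont hx hmin
  have hxx₀ : f x - f x₀ - B (x - x₀) y ≤ -q (x - x₀) := by
    have : f x + (q (x - x₀) - B x y) ≤ f x₀ + (q (x₀ - x₀) - B x₀ y) := hmin hx₀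
    rw [sub_self, map_zero] at this
    rw [map_sub, LinearMap.sub_apply]
    linarith
  have hxε := hy x hx
  have hqx := apply_nonneg q (x - x₀)
  exact ⟨x, hx, z, hz, by linarith, abs_le.2 ⟨by linarith, by linarith⟩,
    abs_pairing_sub_le_of_neg_mem_approxSubdiff hzg⟩

end BrondstedRockafellar

section NormalCone

variable {X : Type u} {Y : Type v} [AddCommGroup X] [Module ℝ X] [AddCommGroup Y] [Module ℝ Y]
  {B : X →ₗ[ℝ] Y →ₗ[ℝ] ℝ} {D : Set X} {f : X → ℝ} {x₀ : X}

theorem nonneg_of_mem_approxSubdiff (hx₀ : x₀ ∈ D) {y : Y} {ε : ℝ}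
    (hy : y ∈ approxSubdiff B D f x₀ ε) : 0 ≤ ε := by
  simpa using hy x₀ hx₀

theorem add_mem_approxSubdiff {g : X → ℝ} {y z : Y} {ε δ : ℝ}
    (hy : y ∈ approxSubdiff B D f x₀ ε) (hz : z ∈ approxSubdiff B D g x₀ δ) :
    y + z ∈ approxSubdiff B D (f + g) x₀ (ε + δ) := fun u hu => by
  rw [map_add, Pi.add_apply, Pi.add_apply]
  linarith [hy u hu, hz u hu]

theorem smul_mem_approxSubdiff {y : Y} {ε c : ℝ} (hc : 0 ≤ c)
    (hy : y ∈ approxSubdiff B D f x₀ ε) :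
    c • y ∈ approxSubdiff B D (c • f) x₀ (c * ε) := fun u hu => by
  simp only [map_smul, Pi.smul_apply, smul_eq_mul]
  linarith [mul_le_mul_of_nonneg_left (hy u hu) hc]

/-- The cone of the pairs `(η, r)` such that `η` is an `r`-subgradient at `x₀` of some nonnegative
multiple of `f`. -/
def approxMultiplierCone (B : X →ₗ[ℝ] Y →ₗ[ℝ] ℝ) (D : Set X) (f : X → ℝ) (x₀ : X) :
    PointedCone ℝ (Y × ℝ) where
  carrier := {p | ∃ l : ℝ, 0 ≤ l ∧ p.1 ∈ approxSubdiff B D (l • f) x₀ p.2}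
  add_mem' := fun ⟨l, hl, hp⟩ ⟨m, hm, hq⟩ =>
    ⟨l + m, add_nonneg hl hm, add_smul l m f ▸ add_mem_approxSubdiff hp hq⟩
  zero_mem' := ⟨0, le_rfl, fun u _ => by simp⟩
  smul_mem' := fun c _ ⟨l, hl, hp⟩ =>
    ⟨c * l, mul_nonneg c.2 hl, mul_smul (c : ℝ) l f ▸ smul_mem_approxSubdiff c.2 hp⟩

/-- The pairs `(ζ, r)` such that `ζ` is an `r`-subgradient at `x₀` of a positive multiple `μ f`
for which `μ f - ⟨·, ζ⟩` is weakly coercive. -/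
def coerciveMultipliers (B : X →ₗ[ℝ] Y →ₗ[ℝ] ℝ) (D : Set X) (f : X → ℝ) (x₀ : X) :
    Set (Y × ℝ) :=
  {p | ∃ μ : ℝ, 0 < μ ∧ p.1 ∈ approxSubdiff B D (μ • f) x₀ p.2 ∧
      WeaklyCoerciveOn B D fun u => (μ • f) u - B u p.1}

theorem add_smul_mem_coerciveMultipliers {p : Y × ℝ} (hp : p ∈ approxMultiplierCone B D f x₀)
    {y₀ : Y} {M : ℝ} (hy₀ : y₀ ∈ approxSubdiff B D f x₀ M)
    (hcoe : WeaklyCoerciveOn B D fun u => f u - B u y₀) {t : ℝ} (ht : 0 < t) :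
    p + t • (y₀, M) ∈ coerciveMultipliers B D f x₀ := by
  obtain ⟨l, hl, hp⟩ := hp
  refine ⟨l + t, add_pos_of_nonneg_of_pos hl ht,
    add_smul l t f ▸ add_mem_approxSubdiff hp (smul_mem_approxSubdiff ht.le hy₀), ?_⟩
  have hbdd : ∀ᶠ u in @cocompact X (weakTopology B) ⊓ 𝓟 D,
      l * f x₀ - B x₀ p.1 - p.2 ≤ l * f u - B u p.1 :=
    eventually_inf_principal.2 <| Eventually.of_forall fun u hu => by
      have := hp u hu
      simp only [map_sub, LinearMap.sub_apply, Pi.smul_apply, smul_eq_mul] at this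
      linarith
  refine (tendsto_atTop_add_left_of_le' _ _ hbdd (hcoe.const_mul_atTop ht)).congr fun u => ?_
  simp only [Pi.smul_apply, smul_eq_mul, Prod.fst_add, Prod.smul_fst, map_add, map_smul]
  ring

variable [TopologicalSpace X] [IsTopologicalAddGroup X] [ContinuousSMul ℝ X]
  [LocallyConvexSpace ℝ X] [TopologicalSpace Y] [IsTopologicalAddGroup Y] [ContinuousSMul ℝ Y]
  [LocallyConvexSpace ℝ Y]

-- A functional `(a, s)` separating `(ξ, 0)` from the closed cone yields, by Fenchel–Moreau, a
-- point `x₀ - (max s 1)⁻¹ • a` of the sublevel set on which `ξ` is positive.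
theorem ClosedConvexOn.mk_zero_mem_closure_approxMultiplierCone (hf : ClosedConvexOn D f)
    (hX : IsCompatible B) (hY : IsCompatible B.flip) (hx₀ : x₀ ∈ D) {ξ : Y}
    (hξ : ξ ∈ normalCone B {x ∈ D | f x ≤ f x₀} x₀) :
    (ξ, (0 : ℝ)) ∈ closure (approxMultiplierCone B D f x₀ : Set (Y × ℝ)) := by
  by_contra hnot
  obtain ⟨φ, hφC, hφξ⟩ := ProperCone.hyperplane_separation_point
    ⟨(approxMultiplierCone B D f x₀).closure, isClosed_closure⟩ hnot
  obtain ⟨a, s, has⟩ := hY.exists_prod_eq φ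
  rw [has, zero_mul, add_zero, LinearMap.flip_apply] at hφξ
  have hσ : 0 < max s 1 := lt_max_of_lt_right one_pos
  have hsub : x₀ - (max s 1)⁻¹ • a ∈ D ∧ f (x₀ - (max s 1)⁻¹ • a) ≤ f x₀ := by
    refine hf.le_of_forall_approxSubdiff hX hx₀ fun ε y hy => ?_
    have hmem : (y, ε) ∈ approxMultiplierCone B D f x₀ := ⟨1, zero_le_one, by rwa [one_smul]⟩
    have hφy : 0 ≤ B a y + ε * s := has y ε ▸ hφC _ (subset_closure hmem)
    have hε := mul_le_mul_of_nonneg_left (le_max_left s 1) (nonneg_of_mem_approxSubdiff hx₀ hy)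
    rw [sub_sub_cancel_left, map_neg, LinearMap.neg_apply, map_smul, LinearMap.smul_apply,
      smul_eq_mul, ← mul_neg, inv_mul_le_iff₀ hσ]
    linarith
  have hξa := hξ _ hsub
  rw [sub_sub_cancel_left, map_neg, LinearMap.neg_apply, map_smul, LinearMap.smul_apply,
    neg_nonpos, smul_eq_mul] at hξa
  exact (mul_neg_of_pos_of_neg (inv_pos.2 hσ) hφξ).not_ge hξa

theorem ClosedConvexOn.mk_zero_mem_closure_coerciveMultipliers (hf : ClosedConvexOn D f)
    (hX : IsCompatible B) (hY : IsCompatible B.flip) (hx₀ : x₀ ∈ D) {y₀ : Y} {M : ℝ}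
    (hy₀ : y₀ ∈ approxSubdiff B D f x₀ M) (hcoe : WeaklyCoerciveOn B D fun u => f u - B u y₀)
    {ξ : Y} (hξ : ξ ∈ normalCone B {x ∈ D | f x ≤ f x₀} x₀) :
    (ξ, (0 : ℝ)) ∈ closure (coerciveMultipliers B D f x₀) := by
  have h0 : (0 : ℝ) ∈ closure (Ioi 0) := by rw [closure_Ioi]; exact self_mem_Ici
  have := map_mem_closure₂ (f := fun (p : Y × ℝ) (t : ℝ) => p + t • (y₀, M)) (by fun_prop)
    (hf.mk_zero_mem_closure_approxMultiplierCone hX hY hx₀ hξ) h0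
    fun p hp t ht => add_smul_mem_coerciveMultipliers hp hy₀ hcoe ht
  simpa using this

end NormalCone

section ScaledSubgradients

variable {X : Type u} {Y : Type v} [AddCommGroup X] [Module ℝ X] [AddCommGroup Y] [Module ℝ Y]
  {B : X →ₗ[ℝ] Y →ₗ[ℝ] ℝ} {D : Set X} {f : X → ℝ} {x₀ : X}

theorem eventually_mem_of_abs_sub_le {ξ : Y} {W : Set Y}
    (hW : W ∈ @nhds Y (weakTopology B.flip) ξ) (p : X → ℝ) :
    ∀ᶠ z : ℝ × Y in 𝓝 0 ×ˢ @nhds Y (weakTopology B.flip) ξ,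
      ∀ v, (∀ a, |B a (v - z.2)| ≤ z.1 * (p a + |B a z.2|)) → v ∈ W := by
  let := weakTopology B.flip
  have := weakTopology_isTopologicalAddGroup B.flip
  obtain ⟨A, δ, hδ, hA⟩ := exists_finset_of_mem_nhds_weakTopology hW
  have hsmall : ∀ a ∈ A, ∀ᶠ z : ℝ × Y in 𝓝 (0, ξ),
      z.1 * (p a + |B a z.2|) + |B a (z.2 - ξ)| < δ := fun a _ => by
    have hcont : Continuous (B a) := (isCompatible_weakTopology B.flip).continuous_pairing a
    refine ContinuousAt.eventually_lt (by fun_prop) continuousAt_const ?_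
    simpa using hδ
  rw [← nhds_prod_eq]
  filter_upwards [A.eventually_all.2 hsmall] with z hz v hv
  refine hA v fun a ha => ?_
  calc |B a (v - ξ)| = |B a (v - z.2) + B a (z.2 - ξ)| := by rw [← map_add, sub_add_sub_cancel]
    _ ≤ |B a (v - z.2)| + |B a (z.2 - ξ)| := abs_add_le _ _
    _ ≤ z.1 * (p a + |B a z.2|) + |B a (z.2 - ξ)| := by gcongr; exact hv a
    _ < δ := hz a ha

variable [TopologicalSpace X] [IsTopologicalAddGroup X] [ContinuousSMul ℝ X]
  [LocallyConvexSpace ℝ X]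

theorem exists_seminorm_of_mem_nhds {U : Set X} (hU : U ∈ 𝓝 x₀) :
    ∃ p : Seminorm ℝ X, Continuous p ∧ ∀ x, p (x - x₀) < 1 → x ∈ U := by
  have hU₀ : (x₀ + ·) ⁻¹' U ∈ 𝓝 (0 : X) :=
    (continuous_const_add x₀).continuousAt (by rwa [add_zero])
  obtain ⟨S, hS, hSU⟩ := (nhds_hasBasis_absConvex_open ℝ X).mem_iff.1 hU₀
  let S : AbsConvexOpenSets ℝ X := ⟨S, hS⟩
  refine ⟨gaugeSeminormFamily ℝ X S, with_gaugeSeminormFamily.continuous_seminorm S,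
    fun x hx => ?_⟩
  rw [← Seminorm.mem_ball_zero, gaugeSeminormFamily_ball] at hx
  simpa using! hSU hx

-- The term `|⟨·, ζ⟩|` of the perturbation `s (p + |⟨·, ζ⟩|)` forces `⟨x - x₀, ζ⟩`, and with it both
-- products, to be small.
theorem ClosedConvexOn.exists_scaled_subgradient_of_mem_coerciveMultipliers
    (hf : ClosedConvexOn D f) (hcomp : IsCompatible B) (hx₀ : x₀ ∈ D) {ζ : Y} {r s : ℝ}
    (hζ : (ζ, r) ∈ coerciveMultipliers B D f x₀) (hs : 0 < s) (hrs : r ≤ s * s)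
    {p : Seminorm ℝ X} (hp : Continuous p) :
    ∃ x ∈ D, ∃ μ > 0, ∃ y ∈ approxSubdiff B D f x 0, p (x - x₀) + |B (x - x₀) ζ| ≤ s ∧
      |μ * (f x - f x₀) - B (x - x₀) ζ| ≤ s * s ∧
      ∀ a, |B a (μ • y - ζ)| ≤ s * (p a + |B a ζ|) := by
  obtain ⟨μ, hμ, hζr, hcoe⟩ := hζ
  lift s to NNReal using hs.le
  let q : Seminorm ℝ X := s • (p + (B.flip ζ).toSeminorm)
  have hq : Continuous q := ((hp.add (hcomp.continuous_pairing ζ).abs).const_smul s :)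
  obtain ⟨x, hx, z, hz, hqx, hfx, hzζ⟩ :=
    (hf.smul hμ).exists_approxSubdiff_near hcomp hx₀ hζr hcoe hq
  refine ⟨x, hx, μ, hμ, μ⁻¹ • z, ?_, le_of_mul_le_mul_left (hqx.trans hrs) hs, ?_, ?_⟩
  · simpa only [inv_smul_smul₀ hμ.ne', mul_zero] using smul_mem_approxSubdiff (inv_pos.2 hμ).le hz
  · simpa only [Pi.smul_apply, smul_eq_mul, ← mul_sub] using hfx.trans hrs
  · simpa only [smul_inv_smul₀ hμ.ne'] using! hzζ

theorem ClosedConvexOn.exists_scaled_subgradient_near (hf : ClosedConvexOn D f)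
    (hcomp : IsCompatible B) (hx₀ : x₀ ∈ D) {y₀ : Y} {M : ℝ}
    (hy₀ : y₀ ∈ approxSubdiff B D f x₀ M) (hcoe : WeaklyCoerciveOn B D fun u => f u - B u y₀)
    {ξ : Y} (hξ : ξ ∈ normalCone B {x ∈ D | f x ≤ f x₀} x₀) {W : Set Y}
    (hW : W ∈ @nhds Y (weakTopology B.flip) ξ) {U : Set X} (hU : U ∈ 𝓝 x₀) {ε : ℝ} (hε : 0 < ε) :
    ∃ x ∈ U, x ∈ D ∧ ∃ μ > 0, ∃ y ∈ approxSubdiff B D f x 0,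
      |μ * (f x - f x₀)| < ε ∧ |μ * B (x - x₀) y| < ε ∧ μ • y ∈ W := by
  let := weakTopology B.flip
  have := weakTopology_isTopologicalAddGroup B.flip
  have := weakTopology_continuousSMul B.flip
  have := weakTopology_locallyConvexSpace B.flip
  obtain ⟨p, hp, hpU⟩ := exists_seminorm_of_mem_nhds hU
  obtain ⟨s, hsW, hs, hsmall⟩ :=
    (((eventually_mem_of_abs_sub_le hW p).curry.filter_mono nhdsWithin_le_nhds).and
      (Ioo_mem_nhdsGT (lt_min one_pos (half_pos hε)))).exists
  obtain ⟨hs1, hsε⟩ := lt_min_iff.1 hsmall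
  have hss : s * s < s := mul_lt_of_lt_one_left hs hs1
  obtain ⟨⟨ζ, r⟩, hζ, hζW, hr⟩ := ((mem_closure_iff_frequently.1
    (hf.mk_zero_mem_closure_coerciveMultipliers hcomp (isCompatible_weakTopology B.flip) hx₀
      hy₀ hcoe hξ)).and_eventually (hsW.prodMk_nhds (eventually_lt_nhds (mul_pos hs hs)))).exists
  obtain ⟨x, hx, μ, hμ, y, hy, hpx, hfx, hyζ⟩ :=
    hf.exists_scaled_subgradient_of_mem_coerciveMultipliers hcomp hx₀ hζ hs hr.le hp
  have hpx₀ := apply_nonneg p (x - x₀)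
  have hyx : |μ * B (x - x₀) y - B (x - x₀) ζ| ≤ s * s := by
    rw [← smul_eq_mul, ← map_smul, ← map_sub]
    exact (hyζ _).trans (mul_le_mul_of_nonneg_left hpx hs.le)
  have hsum : ∀ c, |c - B (x - x₀) ζ| ≤ s * s → |c| < ε := fun c hc => by
    linarith [abs_sub_abs_le_abs_sub c (B (x - x₀) ζ), abs_nonneg (B (x - x₀) ζ)]
  exact ⟨x, hpU x (by linarith [abs_nonneg (B (x - x₀) ζ)]), hx, μ, hμ, y, hy, hsum _ hfx,
    hsum _ hyx, hζW _ hyζ⟩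

end ScaledSubgradients

section GammaZero

variable {X : Type u} {Y : Type v} [AddCommGroup X] [Module ℝ X] [AddCommGroup Y] [Module ℝ Y]
  [TopologicalSpace X] {B : X →ₗ[ℝ] Y →ₗ[ℝ] ℝ} {Φ : X → EReal}

theorem IsGammaZero.coe_toReal (hΦ : IsGammaZero Φ) {x : X} (hx : x ∈ dom Φ) :
    ((Φ x).toReal : EReal) = Φ x :=
  EReal.coe_toReal hx.ne (hΦ.ne_bot x)

theorem IsGammaZero.mem_epi_iff (hΦ : IsGammaZero Φ) {x : X} {r : ℝ} :
    (x, r) ∈ epi Φ ↔ x ∈ dom Φ ∧ (Φ x).toReal ≤ r := by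
  have hdom : (x, r) ∈ epi Φ → x ∈ dom Φ := fun h => h.trans_lt (EReal.coe_lt_top r)
  refine (and_iff_right_of_imp hdom).symm.trans (and_congr_right fun hx => ?_)
  rw [← EReal.coe_le_coe_iff, hΦ.coe_toReal hx]
  rfl

theorem IsGammaZero.sublevel_eq (hΦ : IsGammaZero Φ) {x₀ : X} (hx₀ : x₀ ∈ dom Φ) :
    sublevel Φ (Φ x₀) = {x ∈ dom Φ | (Φ x).toReal ≤ (Φ x₀).toReal} := by
  ext x
  refine Iff.trans ?_ hΦ.mem_epi_iff
  change Φ x ≤ Φ x₀ ↔ Φ x ≤ ((Φ x₀).toReal : EReal)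
  rw [hΦ.coe_toReal hx₀]

theorem IsGammaZero.forall_le_sub_iff (hΦ : IsGammaZero Φ) {g : X → ℝ} {c : ℝ} :
    (∀ u, (g u : EReal) ≤ Φ u - c) ↔ ∀ u ∈ dom Φ, g u ≤ (Φ u).toReal - c := by
  refine forall_congr' fun u => ?_
  by_cases hu : u ∈ dom Φ
  · rw [← hΦ.coe_toReal hu, ← EReal.coe_sub, EReal.coe_le_coe_iff, EReal.toReal_coe]
    exact ⟨fun h _ => h, fun h => h hu⟩
  · have htop : Φ u = ⊤ := not_lt_top_iff.1 hu
    simp [htop, hu]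

theorem IsGammaZero.mem_subdiff_iff (hΦ : IsGammaZero Φ) {x : X} {y : Y} :
    y ∈ subdiff B Φ x ↔ x ∈ dom Φ ∧ y ∈ approxSubdiff B (dom Φ) (fun u => (Φ u).toReal) x 0 := by
  refine and_congr_right fun hx => ?_
  simp only [approxSubdiff, mem_ofPred_eq, add_zero, ← hΦ.forall_le_sub_iff, hΦ.coe_toReal hx]

theorem IsGammaZero.pairing_sub_le_of_conj_le (hΦ : IsGammaZero Φ) {y : Y} {r : ℝ}
    (hy : conj B Φ y ≤ r) {x : X} (hx : x ∈ dom Φ) : B x y - (Φ x).toReal ≤ r := by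
  rw [← EReal.coe_le_coe_iff, EReal.coe_sub, hΦ.coe_toReal hx]
  exact (le_iSup _ x).trans hy

theorem IsGammaZero.closedConvexOn (hΦ : IsGammaZero Φ) :
    ClosedConvexOn (dom Φ) fun x => (Φ x).toReal := by
  have hepi : epi Φ = {p : X × ℝ | p.1 ∈ dom Φ ∧ (Φ p.1).toReal ≤ p.2} :=
    Set.ext fun _ => hΦ.mem_epi_iff
  exact ⟨convexOn_of_convex_epigraph (hepi ▸ hΦ.convex_epi), hepi ▸ hΦ.isClosed_epi⟩

theorem IsGammaZero.exists_weaklyCoerciveOn (hΦ : IsGammaZero Φ) (hepi : EpiPointed B Φ)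
    (x₀ : X) : ∃ (y₀ : Y) (M : ℝ),
      y₀ ∈ approxSubdiff B (dom Φ) (fun u => (Φ u).toReal) x₀ M ∧
      WeaklyCoerciveOn B (dom Φ) fun u => (Φ u).toReal - B u y₀ := by
  obtain ⟨y₀, -, hfin, hcont⟩ := hepi
  obtain ⟨r, hr, -⟩ := EReal.lt_iff_exists_real_btwn.1 (lt_top_iff_ne_top.2 hfin)
  obtain ⟨K, hK, hne, δ, hδ, hKV⟩ :=
    exists_absConvex_of_mem_nhds_mackeyTopology (hcont (Iio_mem_nhds hr))
  have hle : ∀ y, (∀ k ∈ K, |B k y| < δ) → ∀ u ∈ dom Φ, B u (y₀ + y) - (Φ u).toReal ≤ r :=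
    fun y hy u hu => hΦ.pairing_sub_le_of_conj_le (hKV y hy).le hu
  refine ⟨y₀, (Φ x₀).toReal - B x₀ y₀ + r, fun u hu => ?_,
    weaklyCoerciveOn_of_conj_le hK hne hδ (M := r) fun y hy u hu => ?_⟩
  · have := hΦ.pairing_sub_le_of_conj_le hr.le hu
    rw [map_sub, LinearMap.sub_apply]
    linarith
  · have := hle y hy u hu
    rw [map_add] at this
    linarith

end GammaZero

section UpperLimit

theorem upperLimit_mono {U V : Type*} (t : TopologicalSpace V) {l l' : Filter U} (h : l ≤ l')
    (M : U → Set V) : upperLimit t l M ⊆ upperLimit t l' M :=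
  fun _ hv W hW Z hZ => hv W hW Z (h hZ)

variable {X : Type u} {Y : Type v} [AddCommGroup X] [Module ℝ X] [AddCommGroup Y] [Module ℝ Y]
  {B : X →ₗ[ℝ] Y →ₗ[ℝ] ℝ} {Φ : X → EReal} {x₀ : X}

/-- The parameters `(x, μ, x*)` with `x* ∈ ∂Φ(x)` converging along `l` and such that `μ x*`
converges to `ξ` in the weak* topology. -/
def subgradientFilter (B : X →ₗ[ℝ] Y →ₗ[ℝ] ℝ) (Φ : X → EReal) (l : Filter (X × ℝ × Y)) (ξ : Y) :
    Filter (X × ℝ × Y) :=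
  l ⊓ (comap (fun p => p.2.1 • p.2.2) (@nhds Y (weakTopology B.flip) ξ) ⊓
    𝓟 {p | p.2.2 ∈ subdiff B Φ p.1})

theorem subgradientFilter_neBot {l : Filter (X × ℝ × Y)} {ξ : Y}
    (hξ : ξ ∈ upperLimit (weakTopology B.flip) l (scaledSubdiff B Φ)) :
    (subgradientFilter B Φ l ξ).NeBot := by
  refine inf_neBot_iff.2 fun {Z} hZ {R} hR => ?_
  obtain ⟨W, hW, hWR⟩ := mem_comap.1 (mem_inf_principal.1 hR)
  obtain ⟨p, hpZ, _, ⟨hp, rfl⟩, hpW⟩ := hξ W hW Z hZ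
  exact ⟨p, hpZ, hWR hpW hp⟩

theorem tendsto_smul_subgradientFilter (l : Filter (X × ℝ × Y)) (ξ : Y) :
    Tendsto (fun p => p.2.1 • p.2.2) (subgradientFilter B Φ l ξ)
      (@nhds Y (weakTopology B.flip) ξ) :=
  tendsto_comap.mono_left (inf_le_right.trans inf_le_left)

theorem eventually_mem_subdiff_subgradientFilter (l : Filter (X × ℝ × Y)) (ξ : Y) :
    ∀ᶠ p in subgradientFilter B Φ l ξ, p.2.2 ∈ subdiff B Φ p.1 :=
  (inf_le_right.trans inf_le_right : subgradientFilter B Φ l ξ ≤ _) (mem_principal_self _)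

theorem eventually_nonneg_paramFilter : ∀ᶠ p in paramFilter B Φ x₀, 0 ≤ p.2.1 :=
  (inf_le_left.trans inf_le_left : paramFilter B Φ x₀ ≤ _)
    (mem_principal.2 fun _ hp => hp.2)

theorem tendsto_mul_sub_paramFilter :
    Tendsto (fun p => p.2.1 * ((Φ p.1).toReal - (Φ x₀).toReal)) (paramFilter B Φ x₀) (𝓝 0) :=
  tendsto_comap.mono_left (inf_le_left.trans inf_le_right)

theorem tendsto_mul_pairing_paramFilter :
    Tendsto (fun p => p.2.1 * B (p.1 - x₀) p.2.2) (paramFilter B Φ x₀) (𝓝 0) :=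
  tendsto_comap.mono_left inf_le_right

variable [TopologicalSpace X]

theorem exists_of_mem_paramFilterAt {Z : Set (X × ℝ × Y)} (hZ : Z ∈ paramFilterAt B Φ x₀) :
    ∃ U ∈ 𝓝 x₀, ∃ ε > 0, ∀ x ∈ U, x ∈ dom Φ → ∀ (μ : ℝ) (y : Y), 0 ≤ μ →
      |μ * ((Φ x).toReal - (Φ x₀).toReal)| < ε → |μ * B (x - x₀) y| < ε → (x, μ, y) ∈ Z := by
  have h0 := Metric.nhds_basis_ball (x := (0 : ℝ))
  obtain ⟨⟨U, ε, δ⟩, ⟨hU, hε, hδ⟩, hZ⟩ := ((((𝓝 x₀).basis_sets.comap fun p : X × ℝ × Y => p.1).inf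
    (((h0.comap fun p : X × ℝ × Y => p.2.1 * ((Φ p.1).toReal - (Φ x₀).toReal)).principal_inf
      {p | p.1 ∈ dom Φ ∧ 0 ≤ p.2.1}).inf
        (h0.comap fun p : X × ℝ × Y => p.2.1 * B (p.1 - x₀) p.2.2))).mem_iff).1 hZ
  refine ⟨U, hU, min ε δ, lt_min hε hδ, fun x hxU hx μ y hμ hΦx hyx =>
    hZ ⟨hxU, ⟨⟨hx, hμ⟩, ?_⟩, ?_⟩⟩
  · simpa using hΦx.trans_le (min_le_left ε δ)
  · simpa only [mem_preimage, mem_ball_zero_iff, Real.norm_eq_abs] using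
      hyx.trans_le (min_le_right ε δ)

theorem IsGammaZero.upperLimit_subset_normalCone (hΦ : IsGammaZero Φ) (hx₀ : x₀ ∈ dom Φ) :
    upperLimit (weakTopology B.flip) (paramFilter B Φ x₀) (scaledSubdiff B Φ) ⊆
      normalCone B (sublevel Φ (Φ x₀)) x₀ := by
  intro ξ hξ u hu
  rw [hΦ.sublevel_eq hx₀] at hu
  have := subgradientFilter_neBot hξ
  have hle : subgradientFilter B Φ (paramFilter B Φ x₀) ξ ≤ paramFilter B Φ x₀ := inf_le_left
  have hlim : Tendsto (fun p : X × ℝ × Y => B (u - x₀) (p.2.1 • p.2.2))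
      (subgradientFilter B Φ (paramFilter B Φ x₀) ξ) (𝓝 (B (u - x₀) ξ)) :=
    ((WeakBilin.eval_continuous B.flip (u - x₀)).tendsto ξ).comp
      (tendsto_smul_subgradientFilter _ ξ)
  have hbound := (tendsto_mul_pairing_paramFilter (B := B) (Φ := Φ) (x₀ := x₀)).sub
    (tendsto_mul_sub_paramFilter (B := B) (Φ := Φ) (x₀ := x₀))
  rw [sub_zero] at hbound
  refine le_of_tendsto_of_tendsto hlim (hbound.mono_left hle) ?_
  filter_upwards [eventually_mem_subdiff_subgradientFilter _ ξ,
    hle eventually_nonneg_paramFilter] with ⟨x, μ, y⟩ hy hμ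
  have hsub := mul_le_mul_of_nonneg_left ((hΦ.mem_subdiff_iff.1 hy).2 u hu.1) hμ
  have hmul := mul_le_mul_of_nonneg_left hu.2 hμ
  simp only [map_sub, LinearMap.sub_apply, map_smul, smul_eq_mul] at hsub ⊢
  linarith

theorem IsGammaZero.normalCone_subset_upperLimit [IsTopologicalAddGroup X] [ContinuousSMul ℝ X]
    [LocallyConvexSpace ℝ X] (hΦ : IsGammaZero Φ) (hcomp : IsCompatible B)
    (hepi : EpiPointed B Φ) (hx₀ : x₀ ∈ dom Φ) :
    normalCone B (sublevel Φ (Φ x₀)) x₀ ⊆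
      upperLimit (weakTopology B.flip) (paramFilterAt B Φ x₀) (scaledSubdiff B Φ) := by
  intro ξ hξ W hW Z hZ
  rw [hΦ.sublevel_eq hx₀] at hξ
  obtain ⟨U, hU, ε, hε, hZ⟩ := exists_of_mem_paramFilterAt hZ
  obtain ⟨y₀, M, hy₀, hcoe⟩ := hΦ.exists_weaklyCoerciveOn hepi x₀
  obtain ⟨x, hxU, hx, μ, hμ, y, hy, hΦx, hyx, hyW⟩ :=
    hΦ.closedConvexOn.exists_scaled_subgradient_near hcomp hx₀ hy₀ hcoe hξ hW hU hε
  exact ⟨(x, μ, y), hZ x hxU hx μ y hμ.le hΦx hyx, μ • y, ⟨hΦ.mem_subdiff_iff.2 ⟨hx, hy⟩, rfl⟩,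
    hyW⟩

end UpperLimit

section Nets

theorem exists_net_tendsto {α : Type u} (l : Filter α) [l.NeBot] {T : Set α} (hT : T ∈ l) :
    ∃ (ι : Type u) (_ : Preorder ι) (_ : IsDirectedOrder ι) (_ : Nonempty ι) (f : ι → α),
      (∀ i, f i ∈ T) ∧ Tendsto f atTop l := by
  choose f hf using fun S : {S // S ∈ l}ᵒᵈ =>
    Filter.nonempty_of_mem (inter_mem (OrderDual.ofDual S).2 hT)
  refine ⟨{S // S ∈ l}ᵒᵈ, inferInstance, ⟨fun S R => ?_⟩, ⟨OrderDual.toDual ⟨T, hT⟩⟩, f,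
    fun S => (hf S).2, fun S hS => ?_⟩
  · exact ⟨OrderDual.toDual ⟨_, inter_mem (OrderDual.ofDual S).2 (OrderDual.ofDual R).2⟩,
      inter_subset_left, inter_subset_right⟩
  · exact (eventually_ge_atTop (OrderDual.toDual (⟨S, hS⟩ : {S // S ∈ l}))).mono
      fun R hR => hR (hf R).1

theorem exists_net_of_mem_upperLimit {X : Type u} {Y : Type v} [AddCommGroup X] [Module ℝ X]
    [AddCommGroup Y] [Module ℝ Y] [TopologicalSpace X] {B : X →ₗ[ℝ] Y →ₗ[ℝ] ℝ} {Φ : X → EReal}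
    {x₀ : X} {ξ : Y} (hξ : ξ ∈ upperLimit (weakTopology B.flip) (paramFilterAt B Φ x₀)
      (scaledSubdiff B Φ)) :
    ∃ (ι : Type (max u v)) (_ : Preorder ι) (_ : IsDirectedOrder ι) (_ : Nonempty ι)
      (x : ι → X) (μ : ι → ℝ) (y : ι → Y),
      (∀ i, 0 ≤ μ i) ∧ (∀ i, y i ∈ subdiff B Φ (x i)) ∧
      Tendsto x atTop (𝓝 x₀) ∧
      Tendsto (fun i => μ i * ((Φ (x i)).toReal - (Φ x₀).toReal)) atTop (𝓝 0) ∧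
      Tendsto (fun i => μ i * B (x i - x₀) (y i)) atTop (𝓝 0) ∧
      Tendsto (fun i => μ i • y i) atTop (@nhds Y (weakTopology B.flip) ξ) := by
  have := subgradientFilter_neBot hξ
  have hle : subgradientFilter B Φ (paramFilterAt B Φ x₀) ξ ≤ paramFilterAt B Φ x₀ := inf_le_left
  have hle' := hle.trans inf_le_right
  obtain ⟨ι, hpre, hdir, hne, f, hfT, hf⟩ := exists_net_tendsto _
    ((eventually_nonneg_paramFilter.filter_mono hle').and
      (eventually_mem_subdiff_subgradientFilter _ ξ))
  exact ⟨ι, hpre, hdir, hne, fun i => (f i).1, fun i => (f i).2.1, fun i => (f i).2.2,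
    fun i => (hfT i).1, fun i => (hfT i).2,
    tendsto_comap_iff.1 (hf.mono_right (hle.trans inf_le_left)),
    (tendsto_mul_sub_paramFilter.mono_left hle').comp hf,
    (tendsto_mul_pairing_paramFilter.mono_left hle').comp hf,
    (tendsto_smul_subgradientFilter _ ξ).comp hf⟩

end Nets

end DualPair

theorem lemma4p3_general
    {X : Type u} {Y : Type v}
    [AddCommGroup X] [Module ℝ X] [TopologicalSpace X] [IsTopologicalAddGroup X]
    [ContinuousSMul ℝ X] [LocallyConvexSpace ℝ X]
    [AddCommGroup Y] [Module ℝ Y]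
    (B : X →ₗ[ℝ] Y →ₗ[ℝ] ℝ) (hcomp : DualPair.IsCompatible B)
    (Φ : X → EReal) (hΦ : DualPair.IsGammaZero Φ) (hepi : DualPair.EpiPointed B Φ)
    (x₀ : X) (hx₀ : x₀ ∈ DualPair.dom Φ) :
    DualPair.normalCone B (DualPair.sublevel Φ (Φ x₀)) x₀ =
      DualPair.upperLimit (DualPair.weakTopology B.flip) (DualPair.paramFilterAt B Φ x₀)
        (DualPair.scaledSubdiff B Φ) ∧
    (∀ ξ ∈ DualPair.normalCone B (DualPair.sublevel Φ (Φ x₀)) x₀,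
      ∃ (ι : Type (max u v)) (_ : Preorder ι) (_ : IsDirectedOrder ι) (_ : Nonempty ι)
        (x : ι → X) (μ : ι → ℝ) (y : ι → Y),
        (∀ i, 0 ≤ μ i) ∧ (∀ i, y i ∈ DualPair.subdiff B Φ (x i)) ∧
        Tendsto x atTop (𝓝 x₀) ∧
        Tendsto (fun i => μ i * ((Φ (x i)).toReal - (Φ x₀).toReal)) atTop (𝓝 0) ∧
        Tendsto (fun i => μ i * B (x i - x₀) (y i)) atTop (𝓝 0) ∧
        Tendsto (fun i => μ i • y i) atTop (@nhds Y (DualPair.weakTopology B.flip) ξ)) ∧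
    DualPair.normalCone B (DualPair.sublevel Φ (Φ x₀)) x₀ =
      DualPair.upperLimit (DualPair.weakTopology B.flip) (DualPair.paramFilter B Φ x₀)
        (DualPair.scaledSubdiff B Φ) := by
  have hsub := hΦ.normalCone_subset_upperLimit hcomp hepi hx₀
  have hmono := DualPair.upperLimit_mono (DualPair.weakTopology B.flip)
    (inf_le_right : DualPair.paramFilterAt B Φ x₀ ≤ DualPair.paramFilter B Φ x₀)
    (DualPair.scaledSubdiff B Φ)
  have hsup := hΦ.upperLimit_subset_normalCone (B := B) hx₀
  exact ⟨hsub.antisymm (hmono.trans hsup),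
    fun ξ hξ => DualPair.exists_net_of_mem_upperLimit (hsub hξ),
    (hsub.trans hmono).antisymm hsup⟩

theorem lemma4p3
    {X : Type u} {Y : Type v}
    [AddCommGroup X] [Module ℝ X] [TopologicalSpace X] [IsTopologicalAddGroup X]
    [ContinuousSMul ℝ X] [LocallyConvexSpace ℝ X]
    [AddCommGroup Y] [Module ℝ Y]
    (B : X →ₗ[ℝ] Y →ₗ[ℝ] ℝ) (hB : B.Nondegenerate) (hcomp : DualPair.IsCompatible B)
    (Φ : X → EReal) (hΦ : DualPair.IsGammaZero Φ) (hepi : DualPair.EpiPointed B Φ)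
    (x₀ : X) (hx₀ : x₀ ∈ DualPair.dom Φ) :
    -- the upper limit with `x → x₀`
    DualPair.normalCone B (DualPair.sublevel Φ (Φ x₀)) x₀ =
      DualPair.upperLimit (DualPair.weakTopology B.flip) (DualPair.paramFilterAt B Φ x₀)
        (DualPair.scaledSubdiff B Φ) ∧
    -- its reading with nets
    (∀ ξ ∈ DualPair.normalCone B (DualPair.sublevel Φ (Φ x₀)) x₀,
      ∃ (ι : Type (max u v)) (_ : Preorder ι) (_ : IsDirectedOrder ι) (_ : Nonempty ι)
        (x : ι → X) (μ : ι → ℝ) (y : ι → Y),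
        (∀ i, 0 ≤ μ i) ∧ (∀ i, y i ∈ DualPair.subdiff B Φ (x i)) ∧
        Tendsto x atTop (𝓝 x₀) ∧
        Tendsto (fun i => μ i * ((Φ (x i)).toReal - (Φ x₀).toReal)) atTop (𝓝 0) ∧
        Tendsto (fun i => μ i * B (x i - x₀) (y i)) atTop (𝓝 0) ∧
        Tendsto (fun i => μ i • y i) atTop (@nhds Y (DualPair.weakTopology B.flip) ξ)) ∧
    -- the upper limit without `x → x₀`
    DualPair.normalCone B (DualPair.sublevel Φ (Φ x₀)) x₀ =
      DualPair.upperLimit (DualPair.weakTopology B.flip) (DualPair.paramFilter B Φ x₀)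
        (DualPair.scaledSubdiff B Φ) :=
  lemma4p3_general B hcomp Φ hΦ hepi x₀ hx₀
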